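/- Let $n,m\ge 0$ be integers, $T>0$, and let $f:[0,T]\times\mathbb{R}^n\to\mathbb{R}^n$ satisfy: (ii) there is $L\ge 0$ such that $\|f(t,x_1)-f(t,x_2)\|\le L\|x_1-x_2\|$ for all $t\in[0,T]$ and all $x_1,x_2\in\mathbb{R}^n$; (iii) for every $R\ge 0$, $$\Phi(R)=\sup\Big\{\Big\|\tfrac{\partial f}{\partial t}(\cdot,v)\Big\|_{L^2((0,T);\mathbb{R}^n)} \;:\; \|v\|_{L^2((0,T);\mathbb{R}^n)}\le R\Big\}<+\infty ,$$ where $\frac{\partial f}{\partial t}$ is the weak derivative in time (for every fixed $x$, $\frac{\partial f}{\partial t}(\cdot,x)$ is the weak derivative of $f(\cdot,x)$ on $(0,T)$) and $\frac{\partial f}{\partial t}(\cdot,v)$ is the function $t\mapsto\frac{\partial f}{\partial t}(t,v(t))$. For $1\le i\le m$ let $A_i\in\mathbb{R}^{n\times n}$, $B_i\in\mathbb{R}^{n\times 1}$, $C_i\in\mathbb{R}^{1\times n}$, $D_i\in\mathbb{R}$. Let $\mathrm{sgn}$ be the set-valued sign function: $\mathrm{sgn}(r)=\{-1\}$ for $r<0$,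 $\{1\}$ for $r>0$, and $\mathrm{sgn}(0)=[-1,1]$. Suppose that each set-valued map $F_i:x\mapsto (A_ix+B_i)\,\mathrm{sgn}(C_ix+D_i)$ is hypomonotone, i.e. there is $k_i\ge 0$ such that $x\mapsto F_i(x)+k_ix$ is monotone: $\langle x'-y',x-y\rangle\ge -k_i\|x-y\|^2$ for all $x,y\in\mathbb{R}^n$, $x'\in F_i(x)$, $y'\in F_i(y)$. Then for every $x_0\in\mathbb{R}^n$ the differential inclusion $$\dot x(t)\in f(t,x(t))-\sum_{i=1}^m (A_ix(t)+B_i)\,\mathrm{sgn}(C_ix(t)+D_i)\quad\text{for a.e. } t\in(0,T),\qquad x(0)=x_0,$$ has a solution that is Lipschitz continuous on $[0,T]$, and this solution is unique among all absolutely continuous solutions on $[0,T]$. -/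

import Mathlib

open MeasureTheory Set
open scoped NNReal ENNReal ContDiff

noncomputable section

/-- The set-valued sign function, with value `[-1, 1]` at the origin. -/
def sgnSet (r : ℝ) : Set ℝ :=
  if r < 0 then {-1} else if 0 < r then {1} else Icc (-1) 1

/-- The set-valued map `x ↦ (A x + B) sgn (C x + D)` on `ℝⁿ`; the row vector `C` is given as an
element of `ℝⁿ`, so that `C x` is the inner product. -/
def signMap {n : ℕ} (A : Matrix (Fin n) (Fin n) ℝ) (B C : EuclideanSpace ℝ (Fin n)) (D : ℝ)
    (x : EuclideanSpace ℝ (Fin n)) : Set (EuclideanSpace ℝ (Fin n)) :=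
  {y | ∃ s ∈ sgnSet (inner ℝ C x + D), y = s • (Matrix.toEuclideanLin A x + B)}

/-- `F` is monotone. -/
def IsMonotoneSetMap {n : ℕ}
    (F : EuclideanSpace ℝ (Fin n) → Set (EuclideanSpace ℝ (Fin n))) : Prop :=
  ∀ x y, ∀ x' ∈ F x, ∀ y' ∈ F y, 0 ≤ inner ℝ (x' - y') (x - y)

/-- `F` is hypomonotone: `F + k • id` is monotone for some `k ≥ 0`. -/
def IsHypomonotone {n : ℕ}
    (F : EuclideanSpace ℝ (Fin n) → Set (EuclideanSpace ℝ (Fin n))) : Prop :=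
  ∃ k : ℝ, 0 ≤ k ∧ IsMonotoneSetMap (fun x => {y | ∃ w ∈ F x, y = w + k • x})

/-- `u'` is the weak derivative of `u` on the open interval `(0, T)`. -/
def HasWeakDerivOn {n : ℕ} (T : ℝ) (u u' : ℝ → EuclideanSpace ℝ (Fin n)) : Prop :=
  LocallyIntegrableOn u (Ioo 0 T) ∧ LocallyIntegrableOn u' (Ioo 0 T) ∧
    ∀ φ : ℝ → ℝ, ContDiff ℝ ∞ φ → HasCompactSupport φ → tsupport φ ⊆ Ioo 0 T →
      ∫ t in Ioo 0 T, deriv φ t • u t = -∫ t in Ioo 0 T, φ t • u' t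

/-- `f` is Lipschitz in the space variable, uniformly in `t ∈ [0, T]`. -/
def UniformlyLipschitz {n : ℕ} (T : ℝ)
    (f : ℝ → EuclideanSpace ℝ (Fin n) → EuclideanSpace ℝ (Fin n)) : Prop :=
  ∃ L : ℝ, 0 ≤ L ∧ ∀ t ∈ Icc 0 T, ∀ x₁ x₂, ‖f t x₁ - f t x₂‖ ≤ L * ‖x₁ - x₂‖

/-- The (weak) time derivative of `f` maps bounded sets of `L²((0,T); ℝⁿ)` to bounded sets of
`L²((0,T); ℝⁿ)`: here `ft` represents `∂f/∂t`, and `Φ R` is the (finite) supremum of the norms of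
`t ↦ ft t (v t)` over the ball of radius `R`. -/
def TimeDerivBounded {n : ℕ} (T : ℝ)
    (f : ℝ → EuclideanSpace ℝ (Fin n) → EuclideanSpace ℝ (Fin n)) : Prop :=
  ∃ ft : ℝ → EuclideanSpace ℝ (Fin n) → EuclideanSpace ℝ (Fin n),
    (∀ x, HasWeakDerivOn T (fun t => f t x) (fun t => ft t x)) ∧
    (∀ v : ℝ → EuclideanSpace ℝ (Fin n), MemLp v 2 (volume.restrict (Ioo 0 T)) →
      AEStronglyMeasurable (fun t => ft t (v t)) (volume.restrict (Ioo 0 T))) ∧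
    ∃ Φ : ℝ≥0 → ℝ≥0, ∀ R : ℝ≥0,
      (Φ R : ℝ≥0∞) =
        sSup {a : ℝ≥0∞ | ∃ v : ℝ → EuclideanSpace ℝ (Fin n),
          MemLp v 2 (volume.restrict (Ioo 0 T)) ∧
          eLpNorm v 2 (volume.restrict (Ioo 0 T)) ≤ R ∧
          a = eLpNorm (fun t => ft t (v t)) 2 (volume.restrict (Ioo 0 T))}

/-- `x` is an (absolutely continuous) solution on `[0, T]` of
`x' ∈ f(t, x) - ∑ i, F i x` a.e. on `(0, T)`, `x(0) = x₀`. -/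
def IsSolution {n m : ℕ} (T : ℝ)
    (f : ℝ → EuclideanSpace ℝ (Fin n) → EuclideanSpace ℝ (Fin n))
    (F : Fin m → EuclideanSpace ℝ (Fin n) → Set (EuclideanSpace ℝ (Fin n)))
    (x₀ : EuclideanSpace ℝ (Fin n)) (x : ℝ → EuclideanSpace ℝ (Fin n)) : Prop :=
  AbsolutelyContinuousOnInterval x 0 T ∧ x 0 = x₀ ∧
    ∀ᵐ t ∂(volume.restrict (Ioo 0 T)), ∃ w : Fin m → EuclideanSpace ℝ (Fin n),
      (∀ i, w i ∈ F i (x t)) ∧ HasDerivAt x (f t (x t) - ∑ i, w i) t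

end

open Filter Topology

/-! Hypomonotonicity makes the negated sum of the sign maps one-sided Lipschitz, and adding the
Lipschitz field `f` keeps this property. Grönwall's inequality for `‖x - y‖ ^ 2`
(`AbsolutelyContinuousOnInterval.norm_sq_le_of_inner_le`) then gives uniqueness (`IsSolution.eqOn`).

The same inequality gives existence. Replace each `sgn` by a single-valued selection and run the
explicit Euler scheme on the resulting discontinuous equation. Linear growth bounds the velocities
uniformly in the step, and the one-sided Lipschitz condition makes the approximations uniformly
Cauchy (`IsApproxSolution.norm_sub_sq_le`), so they converge to a Lipschitz curve. Its difference
quotients, corrected by the integral of `f`, are limits of averages of the selection at points near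
`x t`. Since the sign maps have compact convex values and are upper semicontinuous, these averages
stay near the value set at `x t`, so the derivative satisfies the inclusion
(`exists_lipschitz_solution`).

Linear growth needs `f(·, 0)` essentially bounded. The bound on `∂f/∂t`, tested on constant
functions, gives an integrable weak derivative, hence bounded oscillation
(`HasWeakDerivOn.exists_ae_norm_le`). -/

/-! ### Grönwall's inequality for absolutely continuous functions -/

theorem AbsolutelyContinuousOnInterval.norm_comp {F : Type*} [SeminormedAddCommGroup F]
    {z : ℝ → F} {a b : ℝ} (hz : AbsolutelyContinuousOnInterval z a b) :
    AbsolutelyContinuousOnInterval (fun t => ‖z t‖) a b := by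
  refine squeeze_zero (fun _ => Finset.sum_nonneg fun _ _ => dist_nonneg) (fun E => ?_) hz
  exact Finset.sum_le_sum fun i _ => by
    simpa [Real.dist_eq, dist_eq_norm] using abs_norm_sub_norm_le (z (E.2 i).1) (z (E.2 i).2)

/-- Grönwall's inequality for an absolutely continuous function satisfying a one-sided estimate
almost everywhere. -/
theorem AbsolutelyContinuousOnInterval.norm_sq_le_of_inner_le {E : Type*} [NormedAddCommGroup E]
    [InnerProductSpace ℝ E] {z : ℝ → E} {T K δ : ℝ} (hK : 0 ≤ K) (hδ : 0 ≤ δ)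
    (hz : AbsolutelyContinuousOnInterval z 0 T) (h0 : z 0 = 0)
    (hder : ∀ᵐ t ∂(volume.restrict (Ioo 0 T)), ∃ z', HasDerivAt z z' t ∧
      inner ℝ (z t) z' ≤ K * ‖z t‖ ^ 2 + δ) {t : ℝ} (ht : t ∈ Icc 0 T) :
    ‖z t‖ ^ 2 ≤ 2 * δ * t * Real.exp (2 * K * t) := by
  have hT : 0 ≤ T := ht.1.trans ht.2
  have hzt : AbsolutelyContinuousOnInterval z 0 t := hz.mono (by
    rw [uIcc_of_le ht.1, uIcc_of_le hT]; exact Icc_subset_Icc_right ht.2)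
  -- Integrating factor: almost everywhere `ψ' ≤ 2δ(exp(-2Ks) - 1) ≤ 0`, and `ψ 0 = 0`.
  set ψ : ℝ → ℝ := fun s => Real.exp (-(2 * K) * s) * (‖z s‖ * ‖z s‖) - 2 * δ * s with hψ
  have hexp : AbsolutelyContinuousOnInterval (fun s => Real.exp (-(2 * K) * s)) 0 t :=
    ContDiffOn.absolutelyContinuousOnInterval (by fun_prop)
  have hlin : AbsolutelyContinuousOnInterval (fun s : ℝ => 2 * δ * s) 0 t :=
    ContDiffOn.absolutelyContinuousOnInterval (by fun_prop)
  have hψac : AbsolutelyContinuousOnInterval ψ 0 t :=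
    (hexp.mul (hzt.norm_comp.mul hzt.norm_comp)).sub hlin
  have hint := hψac.integral_deriv_eq_sub
  have hneg : ∫ s in (0:ℝ)..t, deriv ψ s ≤ 0 := by
    rw [intervalIntegral.integral_of_le ht.1, integral_Ioc_eq_integral_Ioo]
    refine integral_nonpos_of_ae ?_
    filter_upwards [ae_restrict_of_ae_restrict_of_subset (Ioo_subset_Ioo_right ht.2) hder,
      ae_restrict_mem measurableSet_Ioo] with s ⟨z', hz', hle⟩ hs
    have h1 : HasDerivAt (fun s => ‖z s‖ * ‖z s‖) (2 * inner ℝ (z s) z') s := by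
      have := hz'.norm_sq
      simpa only [sq] using this
    have h2 : HasDerivAt (fun s => Real.exp (-(2 * K) * s))
        (Real.exp (-(2 * K) * s) * (-(2 * K))) s := by
      simpa using ((hasDerivAt_id s).const_mul (-(2 * K))).exp
    have h3 : HasDerivAt (fun s : ℝ => 2 * δ * s) (2 * δ) s := by
      simpa using (hasDerivAt_id s).const_mul (2 * δ)
    have h4 := (h2.mul h1).sub h3
    rw [show deriv ψ s = _ from h4.deriv]
    have he : Real.exp (-(2 * K) * s) ≤ 1 := Real.exp_le_one_iff.2 (by
      have := mul_nonneg hK hs.1.le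
      linarith)
    have he0 := Real.exp_pos (-(2 * K) * s)
    have h5 := mul_le_mul_of_nonneg_left hle he0.le
    have h6 := mul_le_mul_of_nonneg_right he hδ
    simp only [Pi.zero_apply]
    nlinarith
  have hle : ψ t - ψ 0 ≤ 0 := hint ▸ hneg
  simp only [hψ, h0, norm_zero, mul_zero, sub_zero] at hle
  have he0 := Real.exp_pos (2 * K * t)
  have h7 : Real.exp (2 * K * t) * Real.exp (-(2 * K) * t) = 1 := by
    rw [← Real.exp_add]; simp
  calc ‖z t‖ ^ 2 = Real.exp (2 * K * t) * (Real.exp (-(2 * K) * t) * (‖z t‖ * ‖z t‖)) := by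
        rw [← mul_assoc, h7]; ring
    _ ≤ Real.exp (2 * K * t) * (2 * δ * t) :=
        mul_le_mul_of_nonneg_left (sub_nonpos.1 hle) he0.le
    _ = _ := by ring

/-! ### Explicit Euler approximations -/

/-- `p` is an approximate solution of `p' = U(t, p)` on `[0, T]` with velocity at most `M`: its
velocity at time `t` is that of `U` at the point `q t`, at distance at most `δ` from `p t`. -/
structure IsApproxSolution {E : Type*} [NormedAddCommGroup E] [NormedSpace ℝ E]
    (U : ℝ → E → E) (x₀ : E) (T M δ : ℝ) (p q : ℝ → E) : Prop where
  aesm : ∀ g : ℝ → E → E, (∀ x, AEStronglyMeasurable (fun s => g s x)) →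
    AEStronglyMeasurable (fun s => g s (q s))
  bound : ∀ t ∈ Icc 0 T, ‖U t (q t)‖ ≤ M
  eq_integral : ∀ t ∈ Icc 0 T, p t = x₀ + ∫ s in (0 : ℝ)..t, U s (q s)
  close : ∀ t ∈ Icc 0 T, ‖p t - q t‖ ≤ δ

section Euler

/-- The floor takes countably many values, and on each level set the space argument is frozen. Joint
measurability of `g` is therefore not needed. -/
theorem aestronglyMeasurable_comp_natFloor {E : Type*} [NormedAddCommGroup E] {g : ℝ → E → E}
    (hg : ∀ x, AEStronglyMeasurable (fun s => g s x)) (a : ℕ → E) (h : ℝ) :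
    AEStronglyMeasurable (fun s => g s (a ⌊s / h⌋₊)) := by
  have hfl : Measurable fun s : ℝ => ⌊s / h⌋₊ := Nat.measurable_floor.comp (measurable_id.div_const h)
  have hms : ∀ k : ℕ, MeasurableSet {s : ℝ | ⌊s / h⌋₊ = k} := fun k =>
    hfl (measurableSet_singleton k)
  have huniv : (⋃ k : ℕ, {s : ℝ | ⌊s / h⌋₊ = k}) = univ := by
    ext s; simp
  rw [← Measure.restrict_univ (μ := volume), ← huniv, aestronglyMeasurable_iUnion_iff]
  intro k
  refine ((hg (a k)).restrict).congr ?_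
  filter_upwards [ae_restrict_mem (hms k)] with s hs
  rw [show ⌊s / h⌋₊ = k from hs]

/-- The nodes of the explicit Euler scheme with time step `h`. -/
noncomputable def eulerNode {E : Type*} [NormedAddCommGroup E] [NormedSpace ℝ E] (U : ℝ → E → E) (x₀ : E) (h : ℝ) : ℕ → E
  | 0 => x₀
  | k + 1 => eulerNode U x₀ h k + ∫ s in (k * h)..((k + 1 : ℕ) * h), U s (eulerNode U x₀ h k)

variable {E : Type*} [NormedAddCommGroup E] [NormedSpace ℝ E]
  {U : ℝ → E → E} {x₀ : E} {c h : ℝ}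

/-- Each step multiplies `1 + ‖·‖` by at most `1 + c * h ≤ exp (c * h)`, so the bound depends on `k
* h` only. -/
theorem one_add_norm_eulerNode_le (hh : 0 ≤ h) (hc : 0 ≤ c)
    (hU : ∀ s x, ‖U s x‖ ≤ c * (1 + ‖x‖)) (k : ℕ) :
    1 + ‖eulerNode U x₀ h k‖ ≤ (1 + ‖x₀‖) * Real.exp (c * (k * h)) := by
  induction k with
  | zero => simp [eulerNode]
  | succ k ih =>
    have h1 : ‖∫ s in (k * h)..((k + 1 : ℕ) * h), U s (eulerNode U x₀ h k)‖
        ≤ c * (1 + ‖eulerNode U x₀ h k‖) * |((k + 1 : ℕ) : ℝ) * h - k * h| :=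
      intervalIntegral.norm_integral_le_of_norm_le_const fun s _ => hU s _
    have h2 : ((k + 1 : ℕ) : ℝ) * h - k * h = h := by push_cast; ring
    rw [h2, abs_of_nonneg hh] at h1
    have h3 : 1 + ‖eulerNode U x₀ h (k + 1)‖ ≤ (1 + ‖eulerNode U x₀ h k‖) * (1 + c * h) := by
      have := norm_add_le (eulerNode U x₀ h k)
        (∫ s in (k * h)..((k + 1 : ℕ) * h), U s (eulerNode U x₀ h k))
      rw [eulerNode]
      linarith
    have h4 : 1 + c * h ≤ Real.exp (c * h) := by
      linarith [Real.add_one_le_exp (c * h)]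
    calc _ ≤ _ := h3
      _ ≤ ((1 + ‖x₀‖) * Real.exp (c * (k * h))) * Real.exp (c * h) :=
          mul_le_mul ih h4 (by positivity) (by positivity)
      _ = _ := by rw [mul_assoc, ← Real.exp_add]; push_cast; ring_nf

/-- Here `q` is the step function through the Euler nodes and `p` the integral curve of its
velocities. They agree at the nodes; after a node, `p` moves at speed at most `M` for a time at most
`h`, whence `δ = M * h`. -/
theorem exists_isApproxSolution (T : ℝ) (hh : 0 < h) (hc : 0 ≤ c)
    (hm : ∀ x, AEStronglyMeasurable (fun s => U s x))
    (hU : ∀ s x, ‖U s x‖ ≤ c * (1 + ‖x‖)) :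
    ∃ p q, IsApproxSolution U x₀ T (c * ((1 + ‖x₀‖) * Real.exp (c * T)))
      (c * ((1 + ‖x₀‖) * Real.exp (c * T)) * h) p q := by
  set M := c * ((1 + ‖x₀‖) * Real.exp (c * T)) with hM
  set a := eulerNode U x₀ h with ha
  set q : ℝ → E := fun s => a ⌊s / h⌋₊ with hq
  have hmeas : ∀ g : ℝ → E → E, (∀ x, AEStronglyMeasurable (fun s => g s x)) →
      AEStronglyMeasurable (fun s => g s (q s)) :=
    fun g hg => aestronglyMeasurable_comp_natFloor hg a h
  have hfloor : ∀ t : ℝ, 0 ≤ t → (⌊t / h⌋₊ : ℝ) * h ≤ t := fun t ht =>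
    (le_div_iff₀ hh).1 (Nat.floor_le (div_nonneg ht hh.le))
  have hgrow : ∀ t : ℝ, 0 ≤ t → ‖U t (q t)‖ ≤ c * ((1 + ‖x₀‖) * Real.exp (c * t)) := by
    intro t ht
    refine (hU t _).trans (mul_le_mul_of_nonneg_left ?_ hc)
    refine (one_add_norm_eulerNode_le hh.le hc hU _).trans ?_
    have := hfloor t ht
    gcongr
  have hbd : ∀ t ∈ Icc 0 T, ‖U t (q t)‖ ≤ M := by
    intro t ht
    refine (hgrow t ht.1).trans ?_
    have := ht.2
    rw [hM]
    gcongr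
  have hint : ∀ s t : ℝ, 0 ≤ s → 0 ≤ t →
      IntervalIntegrable (fun s => U s (q s)) volume s t := by
    intro s t hs ht
    refine (intervalIntegrable_const (c := c * ((1 + ‖x₀‖) * Real.exp (c * max s t)))).mono_fun
      (hmeas U hm).restrict ?_
    filter_upwards [ae_restrict_mem measurableSet_uIoc] with r hr
    have hr0 : 0 ≤ r := (le_min hs ht).trans hr.1.le
    refine (hgrow r hr0).trans ?_
    refine le_trans ?_ (le_abs_self _)
    have : r ≤ max s t := hr.2
    gcongr
  have hnode : ∀ k : ℕ, x₀ + ∫ s in (0 : ℝ)..(k * h), U s (q s) = a k := by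
    intro k
    induction k with
    | zero => simp [ha, eulerNode]
    | succ k ih =>
      rw [← intervalIntegral.integral_add_adjacent_intervals (hint 0 (k * h) le_rfl (by positivity))
        (hint (k * h) _ (by positivity) (by positivity)), ← add_assoc, ih, ha, eulerNode, ← ha]
      congr 1
      refine intervalIntegral.integral_congr_ae ?_
      -- At the right endpoint the floor already equals `k + 1`; this single point is discarded as a
      -- null set.
      have hne : ∀ᵐ s : ℝ, s ≠ ((k + 1 : ℕ) : ℝ) * h := by simp [ae_iff, measure_singleton]
      filter_upwards [hne] with s hs hs'
      have hle : (k : ℝ) * h ≤ ((k + 1 : ℕ) : ℝ) * h := by gcongr; simp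
      rw [uIoc_of_le hle] at hs'
      have hfl : ⌊s / h⌋₊ = k := by
        rw [Nat.floor_eq_iff (div_nonneg ((by positivity : (0:ℝ) ≤ k * h).trans hs'.1.le) hh.le),
          le_div_iff₀ hh, div_lt_iff₀ hh]
        exact ⟨hs'.1.le, by simpa using lt_of_le_of_ne hs'.2 hs⟩
      simp only [hq, hfl]
  refine ⟨fun t => x₀ + ∫ s in (0 : ℝ)..t, U s (q s), q, hmeas, hbd, fun _ _ => rfl, ?_⟩
  intro t ht
  have h1 := hfloor t ht.1
  have h0 : 0 ≤ (⌊t / h⌋₊ : ℝ) * h := by positivity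
  have h2 : t - ⌊t / h⌋₊ * h ≤ h := by
    have := (div_lt_iff₀ hh).1 (Nat.lt_floor_add_one (t / h))
    linarith
  have h3 : (x₀ + ∫ s in (0 : ℝ)..t, U s (q s)) - q t
      = ∫ s in (⌊t / h⌋₊ * h)..t, U s (q s) := by
    rw [← intervalIntegral.integral_add_adjacent_intervals (hint 0 _ le_rfl h0)
      (hint _ t h0 ht.1), ← add_assoc, hnode]
    simp [hq]
  have hM0 : 0 ≤ M := by positivity
  simp only [h3]
  refine (intervalIntegral.norm_integral_le_of_norm_le_const (C := M) fun s hs => ?_).trans ?_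
  · rw [uIoc_of_le h1] at hs
    exact hbd s ⟨h0.trans hs.1.le, hs.2.trans ht.2⟩
  · rw [abs_of_nonneg (by linarith)]
    gcongr

end Euler

/-! ### Regularity and stability of approximate solutions -/

namespace IsApproxSolution

section

variable {E : Type*} [NormedAddCommGroup E] [NormedSpace ℝ E]
  {U : ℝ → E → E} {x₀ : E} {T M δ : ℝ} {p q : ℝ → E}

theorem intervalIntegrable (H : IsApproxSolution U x₀ T M δ p q)
    (hm : ∀ x, AEStronglyMeasurable (fun s => U s x)) {s t : ℝ} (hs : s ∈ Icc 0 T)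
    (ht : t ∈ Icc 0 T) : IntervalIntegrable (fun s => U s (q s)) volume s t := by
  refine (intervalIntegrable_const (c := M)).mono_fun (H.aesm U hm).restrict ?_
  filter_upwards [ae_restrict_mem measurableSet_uIoc] with r hr
  exact (H.bound r ⟨(le_min hs.1 ht.1).trans hr.1.le, hr.2.trans (max_le hs.2 ht.2)⟩).trans
    (le_abs_self _)

theorem sub_eq_integral (H : IsApproxSolution U x₀ T M δ p q)
    (hm : ∀ x, AEStronglyMeasurable (fun s => U s x)) {s t : ℝ} (hs : s ∈ Icc 0 T)
    (ht : t ∈ Icc 0 T) : p t - p s = ∫ r in s..t, U r (q r) := by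
  have h0 : (0 : ℝ) ∈ Icc 0 T := ⟨le_rfl, hs.1.trans hs.2⟩
  rw [H.eq_integral t ht, H.eq_integral s hs, add_sub_add_left_eq_sub,
    intervalIntegral.integral_interval_sub_left (H.intervalIntegrable hm h0 ht)
      (H.intervalIntegrable hm h0 hs)]

theorem norm_sub_le (H : IsApproxSolution U x₀ T M δ p q)
    (hm : ∀ x, AEStronglyMeasurable (fun s => U s x)) {s t : ℝ} (hs : s ∈ Icc 0 T)
    (ht : t ∈ Icc 0 T) : ‖p t - p s‖ ≤ M * |t - s| := by
  rw [H.sub_eq_integral hm hs ht]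
  exact intervalIntegral.norm_integral_le_of_norm_le_const fun r hr =>
    H.bound r ⟨(le_min hs.1 ht.1).trans hr.1.le, hr.2.trans (max_le hs.2 ht.2)⟩

theorem absolutelyContinuousOnInterval (H : IsApproxSolution U x₀ T M δ p q)
    (hm : ∀ x, AEStronglyMeasurable (fun s => U s x)) (hT : 0 ≤ T) :
    AbsolutelyContinuousOnInterval p 0 T := by
  refine LipschitzOnWith.absolutelyContinuousOnInterval (K := M.toNNReal) ?_
  rw [uIcc_of_le hT]
  refine LipschitzOnWith.of_dist_le_mul fun s hs t ht => ?_
  rw [dist_eq_norm, Real.dist_eq]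
  exact (H.norm_sub_le hm ht hs).trans
    (mul_le_mul_of_nonneg_right (Real.le_coe_toNNReal M) (abs_nonneg _))

theorem ae_hasDerivAt [CompleteSpace E] (H : IsApproxSolution U x₀ T M δ p q)
    (hm : ∀ x, AEStronglyMeasurable (fun s => U s x)) :
    ∀ᵐ t ∂(volume.restrict (Ioo 0 T)), HasDerivAt p (U t (q t)) t := by
  rw [ae_restrict_iff' measurableSet_Ioo]
  by_cases hT : 0 ≤ T
  swap
  · refine Eventually.of_forall fun t ht => absurd (ht.1.trans ht.2).le hT
  have h0 : (0 : ℝ) ∈ Icc 0 T := ⟨le_rfl, hT⟩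
  have h1 : T ∈ Icc 0 T := ⟨hT, le_rfl⟩
  filter_upwards [(H.intervalIntegrable hm h0 h1).ae_hasDerivAt_integral] with t ht htT
  rw [uIcc_of_le hT] at ht
  refine ((ht (Ioo_subset_Icc_self htT) 0 h0).const_add x₀).congr_of_eventuallyEq ?_
  filter_upwards [Icc_mem_nhds htT.1 htT.2] with s hs using H.eq_integral s hs

end

section

variable {E : Type*} [NormedAddCommGroup E] [InnerProductSpace ℝ E] [CompleteSpace E]
  {U : ℝ → E → E} {x₀ : E} {T M κ δ δ' : ℝ} {p q p' q' : ℝ → E}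

/-- Two approximate solutions of a one-sided Lipschitz equation are close to each other. -/
theorem norm_sub_sq_le (H : IsApproxSolution U x₀ T M δ p q)
    (H' : IsApproxSolution U x₀ T M δ' p' q')
    (hm : ∀ x, AEStronglyMeasurable (fun s => U s x)) (hκ : 0 ≤ κ) (hM : 0 ≤ M)
    (hδ : 0 ≤ δ) (hδ' : 0 ≤ δ')
    (hosl : ∀ s x y, inner ℝ (x - y) (U s x - U s y) ≤ κ * ‖x - y‖ ^ 2)
    {t : ℝ} (ht : t ∈ Icc 0 T) :
    ‖p t - p' t‖ ^ 2 ≤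
      2 * (2 * κ * (δ + δ') ^ 2 + 2 * M * (δ + δ')) * t * Real.exp (2 * (2 * κ) * t) := by
  have hT : 0 ≤ T := ht.1.trans ht.2
  have h0 : (0 : ℝ) ∈ Icc 0 T := ⟨le_rfl, hT⟩
  refine AbsolutelyContinuousOnInterval.norm_sq_le_of_inner_le (z := fun t => p t - p' t)
    (by positivity) (by positivity)
    ((H.absolutelyContinuousOnInterval hm hT).sub (H'.absolutelyContinuousOnInterval hm hT))
    (by simp [H.eq_integral 0 h0, H'.eq_integral 0 h0]) ?_ ht
  filter_upwards [H.ae_hasDerivAt hm, H'.ae_hasDerivAt hm, ae_restrict_mem measurableSet_Ioo]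
    with s hs hs' hsT
  have hsT' := Ioo_subset_Icc_self hsT
  refine ⟨_, hs.sub hs', ?_⟩
  set w := U s (q s) - U s (q' s) with hw
  set d := (p s - p' s) - (q s - q' s) with hd
  have hwM : ‖w‖ ≤ 2 * M := by
    refine (_root_.norm_sub_le _ _).trans ?_
    linarith [H.bound s hsT', H'.bound s hsT']
  have hdd : ‖d‖ ≤ δ + δ' := by
    have : d = (p s - q s) - (p' s - q' s) := by rw [hd]; abel
    rw [this]
    exact (_root_.norm_sub_le _ _).trans (add_le_add (H.close s hsT') (H'.close s hsT'))
  -- The velocities live at `q` and `q'`, where the one-sided condition applies; the correction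
  -- pairs the small `d` with the bounded `w`. Returning from `q - q'` to `p - p'` doubles `κ` and
  -- adds the quadratic term in `δ + δ'`.
  have h1 : inner ℝ (p s - p' s) w = inner ℝ (q s - q' s) w + inner ℝ d w := by
    rw [← inner_add_left, hd]; congr 1; abel
  have h2 := hosl s (q s) (q' s)
  have h3 : inner ℝ d w ≤ (δ + δ') * (2 * M) :=
    (real_inner_le_norm d w).trans (mul_le_mul hdd hwM (norm_nonneg _) (by positivity))
  have h4 : ‖q s - q' s‖ ≤ ‖p s - p' s‖ + (δ + δ') := by
    have : q s - q' s = (p s - p' s) - d := by rw [hd]; abel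
    rw [this]
    exact (_root_.norm_sub_le _ _).trans (by gcongr)
  have h5 : ‖q s - q' s‖ ^ 2 ≤ 2 * ‖p s - p' s‖ ^ 2 + 2 * (δ + δ') ^ 2 := by
    have := pow_le_pow_left₀ (norm_nonneg _) h4 2
    nlinarith [sq_nonneg (‖p s - p' s‖ - (δ + δ'))]
  have h6 := mul_le_mul_of_nonneg_left h5 hκ
  rw [h1]
  linarith

end

end IsApproxSolution

/-! ### Convergence of the Euler scheme -/

/-- The explicit Euler scheme converges for one-sided Lipschitz equations of linear growth. -/
theorem exists_tendstoUniformlyOn_isApproxSolution {E : Type*} [NormedAddCommGroup E]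
    [InnerProductSpace ℝ E] [CompleteSpace E] {U : ℝ → E → E} (x₀ : E) {T κ c : ℝ} (hT : 0 ≤ T)
    (hm : ∀ x, AEStronglyMeasurable (fun s => U s x)) (hκ : 0 ≤ κ) (hc : 0 ≤ c)
    (hU : ∀ s x, ‖U s x‖ ≤ c * (1 + ‖x‖))
    (hosl : ∀ s x y, inner ℝ (x - y) (U s x - U s y) ≤ κ * ‖x - y‖ ^ 2) :
    ∃ (M : ℝ≥0) (δ : ℕ → ℝ) (P Q : ℕ → ℝ → E) (x : ℝ → E),
      (∀ N, IsApproxSolution U x₀ T M (δ N) (P N) (Q N)) ∧ x 0 = x₀ ∧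
      LipschitzOnWith M x (Icc 0 T) ∧ TendstoUniformlyOn P x atTop (Icc 0 T) ∧
      TendstoUniformlyOn Q x atTop (Icc 0 T) := by
  set M : ℝ≥0 := ⟨c * ((1 + ‖x₀‖) * Real.exp (c * T)), by positivity⟩ with hM
  set η : ℕ → ℝ := fun N => 1 / ((N : ℝ) + 1) with hη
  have hη0 : ∀ N, 0 < η N := fun N => by positivity
  have hη1 : ∀ N, η N ≤ 1 := fun N => by
    rw [hη, div_le_one (by positivity)]; linarith [(Nat.cast_nonneg N : (0:ℝ) ≤ N)]
  have hηlim : Tendsto η atTop (𝓝 0) := tendsto_one_div_add_atTop_nhds_zero_nat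
  choose P Q H using fun N => exists_isApproxSolution (x₀ := x₀) T (hη0 N) hc hm hU
  change ∀ N, IsApproxSolution U x₀ T M (M * η N) (P N) (Q N) at H
  have hδlim : Tendsto (fun N => M * η N) atTop (𝓝 0) := by simpa using hηlim.const_mul (M : ℝ)
  set C : ℝ := 2 * (2 * κ * (2 * M ^ 2) + 2 * M * M) * T * Real.exp (2 * (2 * κ) * T) with hC
  have hC0 : 0 ≤ C := by positivity
  have hclose : ∀ N N', ∀ t ∈ Icc 0 T, ‖P N t - P N' t‖ ^ 2 ≤ C * (η N + η N') := by
    intro N N' t ht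
    refine ((H N).norm_sub_sq_le (H N') hm hκ M.2 (mul_nonneg M.2 (hη0 N).le)
      (mul_nonneg M.2 (hη0 N').le) hosl ht).trans ?_
    have h1 := hη0 N
    have h2 := hη0 N'
    -- Steps of length at most 1 let the quadratic error be absorbed into the linear one.
    have h3 : (η N + η N') ^ 2 ≤ 2 * (η N + η N') := by nlinarith [hη1 N, hη1 N']
    have h4 : 2 * (2 * κ * (M * η N + M * η N') ^ 2 + 2 * M * (M * η N + M * η N'))
        ≤ 2 * (2 * κ * (2 * M ^ 2) + 2 * M * M) * (η N + η N') := by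
      have := mul_le_mul_of_nonneg_left h3 (by positivity : 0 ≤ 4 * κ * (M : ℝ) ^ 2)
      nlinarith
    calc _ ≤ 2 * (2 * κ * (2 * M ^ 2) + 2 * M * M) * (η N + η N') * T *
          Real.exp (2 * (2 * κ) * T) := by
          have h5 := ht.2
          have h6 := ht.1
          have h7 : (0 : ℝ) ≤ 2 * (2 * κ * (2 * M ^ 2) + 2 * M * M) * (η N + η N') := by positivity
          gcongr
      _ = _ := by rw [hC]; ring
  have hcau : UniformCauchySeqOn P atTop (Icc 0 T) := by
    rw [Metric.uniformCauchySeqOn_iff]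
    intro ε hε
    have hlim : Tendsto (fun N => C * (η N + η N)) atTop (𝓝 0) := by
      simpa using (hηlim.add hηlim).const_mul C
    have hev : ∀ᶠ N in atTop, C * η N < ε ^ 2 / 2 := by
      have : Tendsto (fun N => C * η N) atTop (𝓝 0) := by simpa using hηlim.const_mul C
      exact this.eventually_lt_const (by positivity)
    obtain ⟨N₀, hN₀⟩ := eventually_atTop.1 hev
    refine ⟨N₀, fun m hm' n hn t ht => ?_⟩
    rw [dist_eq_norm]
    refine lt_of_pow_lt_pow_left₀ 2 hε.le ((hclose m n t ht).trans_lt ?_)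
    linarith [hN₀ m hm', hN₀ n hn]
  have hpt : ∀ t, ∃ y, t ∈ Icc 0 T → Tendsto (fun N => P N t) atTop (𝓝 y) := by
    intro t
    by_cases ht : t ∈ Icc 0 T
    · obtain ⟨y, hy⟩ := cauchySeq_tendsto_of_complete (hcau.cauchySeq ht)
      exact ⟨y, fun _ => hy⟩
    · exact ⟨0, fun h => absurd h ht⟩
  choose x hx using hpt
  have hPx : TendstoUniformlyOn P x atTop (Icc 0 T) :=
    hcau.tendstoUniformlyOn_of_tendsto fun t ht => hx t ht
  refine ⟨M, fun N => M * η N, P, Q, x, H, ?_, ?_, hPx, ?_⟩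
  · have h0 : (0 : ℝ) ∈ Icc 0 T := ⟨le_rfl, hT⟩
    refine tendsto_nhds_unique (hx 0 h0) ?_
    simp [fun N => (H N).eq_integral 0 h0]
  · refine LipschitzOnWith.of_dist_le_mul fun s hs t ht => ?_
    refine le_of_tendsto ((hx s hs).dist (hx t ht)) (Eventually.of_forall fun N => ?_)
    rw [dist_eq_norm, Real.dist_eq]
    exact (H N).norm_sub_le hm ht hs
  · rw [Metric.tendstoUniformlyOn_iff] at hPx ⊢
    intro ε hε
    filter_upwards [hPx (ε / 2) (half_pos hε), hδlim.eventually_lt_const (half_pos hε)]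
      with N h1 h2 t ht
    have h3 : dist (P N t) (Q N t) ≤ M * η N := by
      rw [dist_eq_norm]; exact (H N).close t ht
    linarith [h1 t ht, dist_triangle (x t) (P N t) (Q N t)]

/-! ### Passage to the limit in the differential inclusion -/

/-- Existence of Lipschitz solutions of `x' ∈ g(t, x) + S(x)`, where `S` is an upper semicontinuous
map with compact convex values that has a one-sided Lipschitz selection `V`. -/
theorem exists_lipschitz_solution {E : Type*} [NormedAddCommGroup E]
    [InnerProductSpace ℝ E] [FiniteDimensional ℝ E] {g : ℝ → E → E} {V : E → E} {S : E → Set E}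
    (x₀ : E) {T κ L c b : ℝ} (hT : 0 ≤ T) (hκ : 0 ≤ κ) (hL : 0 ≤ L) (hc : 0 ≤ c) (hb : 0 ≤ b)
    (hm : ∀ x, AEStronglyMeasurable (fun s => g s x))
    (hg : ∀ s x y, ‖g s x - g s y‖ ≤ L * ‖x - y‖) (hg0 : ∀ s, ‖g s 0‖ ≤ b)
    (hV : ∀ x, ‖V x‖ ≤ c * (1 + ‖x‖))
    (hVosl : ∀ x y, inner ℝ (x - y) (V x - V y) ≤ κ * ‖x - y‖ ^ 2)
    (hSc : ∀ x, Convex ℝ (S x)) (hSk : ∀ x, IsClosed (S x))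
    (hVS : ∀ x, ∀ η > 0, ∀ᶠ y in 𝓝 x, V y ∈ Metric.cthickening η (S x)) :
    ∃ (K : ℝ≥0) (x : ℝ → E), x 0 = x₀ ∧ LipschitzOnWith K x (Icc 0 T) ∧
      ∀ᵐ t ∂(volume.restrict (Ioo 0 T)), ∃ v ∈ S (x t), HasDerivAt x (g t (x t) + v) t := by
  have hgb : ∀ s x, ‖g s x‖ ≤ L * ‖x‖ + b := fun s x => by
    have := norm_le_norm_sub_add (g s x) (g s 0)
    have h2 := hg s x 0
    rw [sub_zero] at h2
    linarith [hg0 s]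
  obtain ⟨M, δ, P, Q, x, H, hx0, hxL, hP, hQ⟩ := exists_tendstoUniformlyOn_isApproxSolution
    (U := fun s x => g s x + V x) (κ := L + κ) (c := (L + b) + c) x₀ hT
    (fun x => (hm x).add aestronglyMeasurable_const) (by positivity) (by positivity)
    (fun s x => by
      have h1 := norm_add_le (g s x) (V x)
      nlinarith [hgb s x, hV x, norm_nonneg x, mul_nonneg hb (norm_nonneg x)])
    (fun s x y => by
      have h1 : (g s x + V x) - (g s y + V y) = (g s x - g s y) + (V x - V y) := by abel
      rw [h1, inner_add_right, add_mul]
      refine add_le_add ((real_inner_le_norm _ _).trans ?_) (hVosl x y)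
      nlinarith [hg s x y, norm_nonneg (x - y)])
  refine ⟨M, x, hx0, hxL, ?_⟩
  have hmU : ∀ x, AEStronglyMeasurable (fun s => g s x + V x) :=
    fun x => (hm x).add aestronglyMeasurable_const
  -- the integral of `g` along the approximations and along the limit
  have hgcont : ∀ s, Continuous (g s) := fun s =>
    (LipschitzWith.of_dist_le_mul (K := ⟨L, hL⟩) fun x y => by
      rw [dist_eq_norm, dist_eq_norm]; exact hg s x y).continuous
  have hgQ : ∀ t ∈ Icc 0 T, Tendsto (fun N => g t (Q N t)) atTop (𝓝 (g t (x t))) := fun t ht =>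
    ((hgcont t).tendsto _).comp (hQ.tendsto_at ht)
  obtain ⟨R, hR⟩ := isCompact_Icc.exists_bound_of_continuousOn hxL.continuousOn
  have hQR : ∀ᶠ N in atTop, ∀ t ∈ Icc 0 T, ‖g t (Q N t)‖ ≤ L * (R + 1) + b := by
    filter_upwards [Metric.tendstoUniformlyOn_iff.1 hQ 1 one_pos] with N hN t ht
    refine (hgb _ _).trans ?_
    have h1 := hN t ht
    rw [dist_eq_norm'] at h1
    have h2 := norm_le_norm_sub_add (Q N t) (x t)
    have h3 : ‖Q N t‖ ≤ R + 1 := by linarith [hR t ht]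
    gcongr
  have h0T : (0 : ℝ) ∈ Icc 0 T := ⟨le_rfl, hT⟩
  have hTT : T ∈ Icc 0 T := ⟨hT, le_rfl⟩
  have hIsub : ∀ {s t : ℝ}, s ∈ Icc 0 T → t ∈ Icc 0 T → uIoc s t ⊆ Icc 0 T := fun hs ht =>
    uIoc_subset_uIcc.trans (ordConnected_Icc.uIcc_subset hs ht)
  have hyint : ∀ {s t : ℝ}, s ∈ Icc 0 T → t ∈ Icc 0 T →
      IntervalIntegrable (fun r => g r (x r)) volume s t := by
    intro s t hs ht
    -- Measurability along the limit curve is inherited from the step functions `Q N`.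
    have hmeas : AEStronglyMeasurable (fun r => g r (x r)) (volume.restrict (uIoc s t)) := by
      refine aestronglyMeasurable_of_tendsto_ae atTop (f := fun N r => g r (Q N r))
        (fun N => ((H N).aesm g hm).restrict) ?_
      filter_upwards [ae_restrict_mem measurableSet_uIoc] with r hr using hgQ r (hIsub hs ht hr)
    refine (intervalIntegrable_const (c := L * R + b)).mono_fun hmeas ?_
    filter_upwards [ae_restrict_mem measurableSet_uIoc] with r hr
    refine ((hgb _ _).trans ?_).trans (le_abs_self _)
    have := hR r (hIsub hs ht hr)
    gcongr
  have hQint : ∀ᶠ N in atTop, ∀ {s t : ℝ}, s ∈ Icc 0 T → t ∈ Icc 0 T →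
      IntervalIntegrable (fun r => g r (Q N r)) volume s t := by
    filter_upwards [hQR] with N hN s t hs ht
    refine (intervalIntegrable_const (c := L * (R + 1) + b)).mono_fun
      ((H N).aesm g hm).restrict ?_
    filter_upwards [ae_restrict_mem measurableSet_uIoc] with r hr
    exact (hN r (hIsub hs ht hr)).trans (le_abs_self _)
  have hlim : ∀ {s t : ℝ}, s ∈ Icc 0 T → t ∈ Icc 0 T →
      Tendsto (fun N => ∫ r in s..t, g r (Q N r)) atTop (𝓝 (∫ r in s..t, g r (x r))) := by
    intro s t hs ht
    refine intervalIntegral.tendsto_integral_filter_of_dominated_convergence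
      (fun _ => L * (R + 1) + b) (Eventually.of_forall fun N => ((H N).aesm g hm).restrict) ?_
      intervalIntegrable_const ?_
    · filter_upwards [hQR] with N hN
      exact Eventually.of_forall fun r hr => hN r (hIsub hs ht hr)
    · exact Eventually.of_forall fun r hr => hgQ r (hIsub hs ht hr)
  -- For each `N` the corrected quotient is the average of `V (Q N r)` over `(t, t']`. Near `t` and
  -- for large `N` the integrand lies in a closed convex thickening of `S (x t)`, so the average and
  -- its limit in `N` do too.
  have key : ∀ t ∈ Ioo 0 T, ∀ η > 0, ∀ᶠ t' in 𝓝[>] t,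
      (t' - t)⁻¹ • ((x t' - x t) - ∫ r in t..t', g r (x r)) ∈
        Metric.cthickening η (S (x t)) := by
    intro t ht η hη
    have htI := Ioo_subset_Icc_self ht
    obtain ⟨ρ, hρ, hρV⟩ := Metric.eventually_nhds_iff.1 (hVS (x t) η hη)
    have hxc : ContinuousAt x t := hxL.continuousOn.continuousAt (Icc_mem_nhds ht.1 ht.2)
    obtain ⟨ε, hε, hεx⟩ := Metric.continuousAt_iff.1 hxc (ρ / 2) (half_pos hρ)
    have hlt : t < min T (t + ε) := lt_min ht.2 (by linarith)
    filter_upwards [Ioo_mem_nhdsGT hlt] with t' ht'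
    have ht'T : t' < T := ht'.2.trans_le (min_le_left _ _)
    have ht'ε : t' < t + ε := ht'.2.trans_le (min_le_right _ _)
    have ht'I : t' ∈ Icc 0 T := ⟨htI.1.trans ht'.1.le, ht'T.le⟩
    refine Metric.isClosed_cthickening.mem_of_tendsto
      ((((hP.tendsto_at ht'I).sub (hP.tendsto_at htI)).sub (hlim htI ht'I)).const_smul
        (t' - t)⁻¹) ?_
    filter_upwards [Metric.tendstoUniformlyOn_iff.1 hQ (ρ / 2) (half_pos hρ), hQint]
      with N hN hgi
    have hUi := (H N).intervalIntegrable hmU htI ht'I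
    -- `V` is not assumed measurable; along `Q N` it is a difference of two integrable functions.
    have hVi : IntervalIntegrable (fun r => V (Q N r)) volume t t' := by
      simpa using hUi.sub (hgi htI ht'I)
    have hsplit : (P N t' - P N t) - ∫ r in t..t', g r (Q N r) = ∫ r in t..t', V (Q N r) := by
      rw [(H N).sub_eq_integral hmU htI ht'I,
        intervalIntegral.integral_add (hgi htI ht'I) hVi, add_sub_cancel_left]
    have havg : (t' - t)⁻¹ • ∫ r in t..t', V (Q N r) = ⨍ r in Ioc t t', V (Q N r) := by
      rw [setAverage_eq, intervalIntegral.integral_of_le ht'.1.le, Measure.real, Real.volume_Ioc,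
        ENNReal.toReal_ofReal (sub_nonneg.2 ht'.1.le)]
    rw [hsplit, havg]
    refine ((hSc (x t)).cthickening η).set_average_mem Metric.isClosed_cthickening
      (by simpa using ht'.1) (by simp) ?_ hVi.1
    filter_upwards [ae_restrict_mem measurableSet_Ioc] with r hr
    have hrI : r ∈ Icc 0 T := ⟨htI.1.trans hr.1.le, hr.2.trans ht'T.le⟩
    refine hρV ?_
    have h1 := hN r hrI
    rw [dist_comm] at h1
    have h2 : dist (x r) (x t) < ρ / 2 := hεx (by
      rw [Real.dist_eq, abs_of_pos (sub_pos.2 hr.1)]; linarith [hr.2])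
    linarith [dist_triangle (Q N r) (x r) (x t)]
  have hdiff : ∀ᵐ t ∂(volume.restrict (Ioo 0 T)), DifferentiableAt ℝ x t := by
    rw [ae_restrict_iff' measurableSet_Ioo]
    filter_upwards [hxL.ae_differentiableWithinAt_of_mem_real] with t ht htI
    exact (ht (Ioo_subset_Icc_self htI)).differentiableAt (Icc_mem_nhds htI.1 htI.2)
  have hder : ∀ᵐ t ∂(volume.restrict (Ioo 0 T)),
      HasDerivAt (fun t => ∫ r in (0 : ℝ)..t, g r (x r)) (g t (x t)) t := by
    rw [ae_restrict_iff' measurableSet_Ioo]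
    filter_upwards [(hyint h0T hTT).ae_hasDerivAt_integral] with t ht htI
    rw [uIcc_of_le hT] at ht
    exact ht (Ioo_subset_Icc_self htI) 0 h0T
  filter_upwards [hdiff, hder, ae_restrict_mem measurableSet_Ioo] with t hxt hGt htI
  refine ⟨deriv x t - g t (x t), ?_, by simpa using hxt.hasDerivAt⟩
  -- A closed set is the intersection of its thickenings, so it suffices to let `t'` tend to `t` for
  -- each fixed `η`.
  rw [← (hSk (x t)).closure_eq, Metric.closure_eq_iInter_cthickening]
  refine mem_iInter₂.2 fun η hη => ?_
  have hslope := (hxt.hasDerivAt.sub hGt).tendsto_slope.mono_left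
    (nhdsWithin_mono t fun s (hs : t < s) => ne_of_gt hs : 𝓝[>] t ≤ 𝓝[≠] t)
  refine Metric.isClosed_cthickening.mem_of_tendsto hslope ?_
  filter_upwards [key t htI η hη, Ioo_mem_nhdsGT htI.2] with t' ht' ht'T
  have ht'I : t' ∈ Icc 0 T := ⟨htI.1.le.trans ht'T.1.le, ht'T.2.le⟩
  rw [← intervalIntegral.integral_interval_sub_left (hyint h0T ht'I)
    (hyint h0T (Ioo_subset_Icc_self htI))] at ht'
  rw [slope_def_module]
  convert ht' using 2
  simp only [Pi.sub_apply]
  abel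

/-! ### Essential boundedness from an integrable weak derivative -/

/-- The primitive of `η - η'` vanishes beyond `b` because the two masses cancel, and it is a
difference of two numbers in `[0, 1]`. It is the test function that compares two local averages of
`u`. -/
theorem exists_contDiff_primitive_of_integral_eq {η η' : ℝ → ℝ} {T a b : ℝ}
    (hη : ContDiff ℝ ∞ η) (hη' : ContDiff ℝ ∞ η') (h0 : ∀ t, 0 ≤ η t) (h0' : ∀ t, 0 ≤ η' t)
    (hs : ∀ t, t ∉ Icc a b → η t = 0) (hs' : ∀ t, t ∉ Icc a b → η' t = 0)
    (hi : ∫ t, η t = 1) (hi' : ∫ t, η' t = 1) (ha : 0 < a) (hb : b < T) :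
    ∃ φ : ℝ → ℝ, ContDiff ℝ ∞ φ ∧ HasCompactSupport φ ∧ tsupport φ ⊆ Ioo 0 T ∧
      (∀ t ∈ Ioo 0 T, |φ t| ≤ 1) ∧ ∀ t, deriv φ t = η t - η' t := by
  have hle : ∀ {η : ℝ → ℝ}, ContDiff ℝ ∞ η → (∀ t, 0 ≤ η t) → (∀ t, t ∉ Icc a b → η t = 0) →
      ∫ t, η t = 1 → ∀ t, 0 ≤ t → (∫ s in (0 : ℝ)..t, η s) ∈ Icc (0 : ℝ) 1 := by
    intro η hη h0 hs hi t ht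
    refine ⟨intervalIntegral.integral_nonneg ht fun s _ => h0 s, ?_⟩
    have hint : Integrable η := hη.continuous.integrable_of_hasCompactSupport
      (HasCompactSupport.intro isCompact_Icc fun t ht => hs t ht)
    rw [← hi, intervalIntegral.integral_of_le ht]
    exact setIntegral_le_integral hint (Eventually.of_forall h0)
  have hone : ∀ {η : ℝ → ℝ}, (∀ t, t ∉ Icc a b → η t = 0) →
      ∫ t, η t = 1 → ∀ t, b < t → (∫ s in (0 : ℝ)..t, η s) = 1 := by
    intro η hs hi t ht
    rw [intervalIntegral.integral_eq_integral_of_support_subset, hi]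
    intro s hs'
    by_contra hst
    refine hs' (hs s fun hsab => hst ⟨ha.trans_le hsab.1, hsab.2.trans ht.le⟩)
  have hc : Continuous fun t => η t - η' t := hη.continuous.sub hη'.continuous
  set φ : ℝ → ℝ := fun t => ∫ s in (0 : ℝ)..t, (η s - η' s) with hφ
  have hsub : ∀ t, φ t = (∫ s in (0 : ℝ)..t, η s) - ∫ s in (0 : ℝ)..t, η' s := fun t =>
    intervalIntegral.integral_sub (hη.continuous.intervalIntegrable _ _)
      (hη'.continuous.intervalIntegrable _ _)
  have hder : ∀ t, HasDerivAt φ (η t - η' t) t := fun t => hc.integral_hasStrictDerivAt 0 t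
    |>.hasDerivAt
  have hderiv : deriv φ = fun t => η t - η' t := funext fun t => (hder t).deriv
  have hzero : ∀ t, t ∉ Icc a b → φ t = 0 := by
    intro t ht
    rcases lt_or_ge t a with h | h
    · refine (intervalIntegral.integral_congr (g := fun _ => (0 : ℝ)) fun s hst => ?_).trans
        (by simp)
      have hsa : s ∉ Icc a b := fun h' => by
        have := hst.2.trans_lt (max_lt ha h)
        exact absurd h'.1 (not_le.2 this)
      simp [hs s hsa, hs' s hsa]
    · have hbt : b < t := not_le.1 fun h' => ht ⟨h, h'⟩
      rw [hsub, hone hs hi t hbt, hone hs' hi' t hbt, sub_self]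
  have htsup : tsupport φ ⊆ Icc a b :=
    closure_minimal (fun t ht => by_contra fun h => ht (hzero t h)) isClosed_Icc
  refine ⟨φ, ?_, HasCompactSupport.intro isCompact_Icc hzero,
    htsup.trans (Icc_subset_Ioo ha hb), fun t ht => ?_, fun t => (hder t).deriv⟩
  · rw [contDiff_infty_iff_deriv, hderiv]
    exact ⟨fun t => (hder t).differentiableAt, hη.sub hη'⟩
  · rw [hsub]
    have h1 := hle hη h0 hs hi t ht.1.le
    have h2 := hle hη' h0' hs' hi' t ht.1.le
    rw [abs_le]
    constructor <;> linarith [h1.1, h1.2, h2.1, h2.2]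

namespace HasWeakDerivOn

variable {n : ℕ} {T : ℝ} {u u' : ℝ → EuclideanSpace ℝ (Fin n)}

/-- With `φ' = η - η'` the difference of averages is `∫ φ' u = -∫ φ u'`, and `|φ| ≤ 1`. The
indicator turns the locally integrable `u` into a function integrable on the line without changing
the averages. -/
theorem norm_integral_smul_sub_le (h : HasWeakDerivOn T u u') (hu' : IntegrableOn u' (Ioo 0 T))
    {η η' : ℝ → ℝ} {a b : ℝ}
    (hη : ContDiff ℝ ∞ η) (hη' : ContDiff ℝ ∞ η') (h0 : ∀ t, 0 ≤ η t) (h0' : ∀ t, 0 ≤ η' t)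
    (hs : ∀ t, t ∉ Icc a b → η t = 0) (hs' : ∀ t, t ∉ Icc a b → η' t = 0)
    (hi : ∫ t, η t = 1) (hi' : ∫ t, η' t = 1) (ha : 0 < a) (hb : b < T) :
    ‖(∫ t, η t • (Icc a b).indicator u t) - ∫ t, η' t • (Icc a b).indicator u t‖
      ≤ ∫ t in Ioo 0 T, ‖u' t‖ := by
  obtain ⟨φ, hφ, hφc, hφs, hφ1, hφd⟩ :=
    exists_contDiff_primitive_of_integral_eq hη hη' h0 h0' hs hs' hi hi' ha hb
  have hsubset : Icc a b ⊆ Ioo 0 T := Icc_subset_Ioo ha hb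
  have hw : Integrable ((Icc a b).indicator u) :=
    (h.1.integrableOn_compact_subset hsubset isCompact_Icc).integrable_indicator measurableSet_Icc
  have hbd : ∀ {η : ℝ → ℝ}, ContDiff ℝ ∞ η → (∀ t, t ∉ Icc a b → η t = 0) →
      Integrable fun t => η t • (Icc a b).indicator u t := by
    intro η hη hs
    obtain ⟨C, hC⟩ := hη.continuous.bounded_above_of_compact_support
      (HasCompactSupport.intro isCompact_Icc hs)
    exact hw.bdd_smul C hη.continuous.aestronglyMeasurable (Eventually.of_forall hC)
  rw [← integral_sub (hbd hη hs) (hbd hη' hs')]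
  have heq : ∫ t, (η t • (Icc a b).indicator u t - η' t • (Icc a b).indicator u t)
      = ∫ t in Ioo 0 T, deriv φ t • u t := by
    rw [← setIntegral_eq_integral_of_forall_compl_eq_zero (s := Ioo 0 T)]
    · refine setIntegral_congr_fun measurableSet_Ioo fun t _ => ?_
      simp only [hφd]
      by_cases ht : t ∈ Icc a b
      · simp [indicator_of_mem ht, sub_smul]
      · simp [hs t ht, hs' t ht]
    · intro t ht
      simp [hs t fun h => ht (hsubset h), hs' t fun h => ht (hsubset h)]
  rw [heq, h.2.2 φ hφ hφc hφs, norm_neg]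
  refine norm_integral_le_of_norm_le hu'.norm ?_
  filter_upwards [ae_restrict_mem measurableSet_Ioo] with t ht
  rw [norm_smul]
  exact mul_le_of_le_one_left (norm_nonneg _) (hφ1 t ht)

/-- A function on `(0, T)` with an integrable weak derivative is essentially bounded. -/
theorem exists_ae_norm_le (h : HasWeakDerivOn T u u') (hu' : IntegrableOn u' (Ioo 0 T)) :
    ∃ b, 0 ≤ b ∧ ∀ᵐ t ∂(volume.restrict (Ioo 0 T)), ‖u t‖ ≤ b := by
  -- The fixed ratio 2 of outer to inner radius is what almost everywhere convergence of the
  -- mollifications requires.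
  let ψ : ℕ → ContDiffBump (0 : ℝ) := fun i =>
    ⟨1 / ((i : ℝ) + 1) / 2, 1 / ((i : ℝ) + 1), by positivity, half_lt_self (by positivity)⟩
  have hψ : Tendsto (fun i => (ψ i).rOut) atTop (𝓝 0) := tendsto_one_div_add_atTop_nhds_zero_nat
  -- Rational endpoints keep the family of truncations countable, so one null set serves them all.
  have hconv : ∀ᵐ s : ℝ, ∀ a b : ℚ, 0 < (a : ℝ) → (b : ℝ) < T →
      Tendsto (fun i => ∫ t, (ψ i).normed volume (s - t) • (Icc (a : ℝ) b).indicator u t) atTop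
        (𝓝 ((Icc (a : ℝ) b).indicator u s)) := by
    simp only [ae_all_iff]
    intro a b ha hb
    have hw : Integrable ((Icc (a : ℝ) b).indicator u) :=
      (h.1.integrableOn_compact_subset (Icc_subset_Ioo ha hb)
        isCompact_Icc).integrable_indicator measurableSet_Icc
    filter_upwards [ContDiffBump.ae_convolution_tendsto_right_of_locallyIntegrable (K := 2) hψ
      (Eventually.of_forall fun i => le_of_eq (by simp only [ψ]; ring)) hw.locallyIntegrable]
      with s hs
    simpa only [convolution_eq_swap, ContinuousLinearMap.lsmul_apply] using hs
  have hpair : ∀ s ∈ Ioo 0 T, ∀ t ∈ Ioo 0 T,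
      (∀ a b : ℚ, 0 < (a : ℝ) → (b : ℝ) < T →
        Tendsto (fun i => ∫ r, (ψ i).normed volume (s - r) • (Icc (a : ℝ) b).indicator u r) atTop
          (𝓝 ((Icc (a : ℝ) b).indicator u s))) →
      (∀ a b : ℚ, 0 < (a : ℝ) → (b : ℝ) < T →
        Tendsto (fun i => ∫ r, (ψ i).normed volume (t - r) • (Icc (a : ℝ) b).indicator u r) atTop
          (𝓝 ((Icc (a : ℝ) b).indicator u t))) →
      ‖u s - u t‖ ≤ ∫ t in Ioo 0 T, ‖u' t‖ := by
    intro s hs t ht hs' ht'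
    obtain ⟨a, ha, hast⟩ := exists_rat_btwn (lt_min hs.1 ht.1)
    obtain ⟨b, hbst, hb⟩ := exists_rat_btwn (max_lt hs.2 ht.2)
    have hlim := ((hs' a b ha hb).sub (ht' a b ha hb)).norm
    have has := hast.trans_le (min_le_left _ _)
    have hat := hast.trans_le (min_le_right _ _)
    have hbs := (le_max_left _ _).trans_lt hbst
    have hbt := (le_max_right _ _).trans_lt hbst
    rw [indicator_of_mem (show s ∈ Icc (a : ℝ) b from ⟨has.le, hbs.le⟩),
      indicator_of_mem (show t ∈ Icc (a : ℝ) b from ⟨hat.le, hbt.le⟩)] at hlim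
    have hev : ∀ {r : ℝ}, (a : ℝ) < r → r < b → ∀ᶠ i in atTop, ∀ t, t ∉ Icc (a : ℝ) b →
        (ψ i).normed volume (r - t) = 0 := by
      intro r har hrb
      filter_upwards [hψ.eventually_lt_const (lt_min (sub_pos.2 har) (sub_pos.2 hrb))]
        with i hi t ht
      by_contra hne
      have hmem : r - t ∈ Function.support ((ψ i).normed volume) := hne
      rw [ContDiffBump.support_normed_eq, mem_ball_zero_iff, Real.norm_eq_abs, abs_lt] at hmem
      have h1 := hi.trans_le (min_le_left _ _)
      have h2 := hi.trans_le (min_le_right _ _)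
      exact ht ⟨by linarith, by linarith⟩
    refine le_of_tendsto hlim ?_
    filter_upwards [hev has hbs, hev hat hbt] with i hi hi'
    have hsm : ∀ r : ℝ, ContDiff ℝ ∞ fun t => (ψ i).normed volume (r - t) := fun r =>
      (ψ i).contDiff_normed.comp (contDiff_const.sub contDiff_id)
    have hint : ∀ r : ℝ, ∫ t, (ψ i).normed volume (r - t) = 1 := fun r => by
      rw [integral_sub_left_eq_self (fun t => (ψ i).normed volume t), ContDiffBump.integral_normed]
    exact h.norm_integral_smul_sub_le hu' (hsm s) (hsm t) (fun _ => (ψ i).nonneg_normed _)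
      (fun _ => (ψ i).nonneg_normed _) hi hi' (hint s) (hint t) ha hb
  -- One point of convergence `t₀` anchors the oscillation bound; if none exists, almost every point
  -- being one makes the claim vacuous.
  by_cases hne : ∃ t₀ ∈ Ioo 0 T, ∀ a b : ℚ, 0 < (a : ℝ) → (b : ℝ) < T →
      Tendsto (fun i => ∫ t, (ψ i).normed volume (t₀ - t) • (Icc (a : ℝ) b).indicator u t) atTop
        (𝓝 ((Icc (a : ℝ) b).indicator u t₀))
  · obtain ⟨t₀, ht₀, hgood⟩ := hne
    refine ⟨(∫ t in Ioo 0 T, ‖u' t‖) + ‖u t₀‖, by positivity, ?_⟩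
    filter_upwards [ae_restrict_of_ae hconv, ae_restrict_mem measurableSet_Ioo] with s hs hsT
    linarith [norm_le_norm_sub_add (u s) (u t₀), hpair s hsT t₀ ht₀ hs hgood]
  · refine ⟨0, le_rfl, ?_⟩
    filter_upwards [ae_restrict_of_ae hconv, ae_restrict_mem measurableSet_Ioo] with s hs hsT
    exact absurd ⟨s, hsT, hs⟩ hne

end HasWeakDerivOn

/-! ### The set-valued sign and the sign maps -/

theorem sgnSet_subset (r : ℝ) : sgnSet r ⊆ Icc (-1) 1 := by
  unfold sgnSet
  split_ifs <;> simp

theorem isCompact_sgnSet (r : ℝ) : IsCompact (sgnSet r) := by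
  unfold sgnSet
  split_ifs
  exacts [isCompact_singleton, isCompact_singleton, isCompact_Icc]

theorem convex_sgnSet (r : ℝ) : Convex ℝ (sgnSet r) := by
  unfold sgnSet
  split_ifs
  exacts [convex_singleton _, convex_singleton _, convex_Icc _ _]

/-- A single-valued selection of `sgnSet`. -/
noncomputable def sgnSelection (r : ℝ) : ℝ := if r < 0 then -1 else 1

theorem sgnSelection_mem (r : ℝ) : sgnSelection r ∈ sgnSet r := by
  unfold sgnSelection sgnSet
  split_ifs <;> simp

theorem eventually_sgnSelection_mem (r : ℝ) : ∀ᶠ r' in 𝓝 r, sgnSelection r' ∈ sgnSet r := by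
  rcases lt_trichotomy r 0 with h | h | h
  · filter_upwards [eventually_lt_nhds h] with r' hr'
    simp [sgnSelection, sgnSet, h, hr']
  · refine Eventually.of_forall fun r' => ?_
    have := sgnSet_subset r' (sgnSelection_mem r')
    simpa [sgnSet, h] using this
  · filter_upwards [eventually_gt_nhds h] with r' hr'
    simp [sgnSelection, sgnSet, h, h.not_gt, hr'.not_gt]

section SignMap

variable {n : ℕ} (A : Matrix (Fin n) (Fin n) ℝ) (B C : EuclideanSpace ℝ (Fin n)) (D : ℝ)

theorem signMap_eq_image (x : EuclideanSpace ℝ (Fin n)) :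
    signMap A B C D x =
      (fun s : ℝ => s • (Matrix.toEuclideanLin A x + B)) '' sgnSet (inner ℝ C x + D) := by
  ext y
  simp [signMap, eq_comm]

theorem isCompact_signMap (x : EuclideanSpace ℝ (Fin n)) : IsCompact (signMap A B C D x) := by
  rw [signMap_eq_image]
  exact (isCompact_sgnSet _).image (by fun_prop)

theorem convex_signMap (x : EuclideanSpace ℝ (Fin n)) : Convex ℝ (signMap A B C D x) := by
  rw [signMap_eq_image]
  exact (convex_sgnSet _).is_linear_image
    (LinearMap.toSpanSingleton ℝ _ (Matrix.toEuclideanLin A x + B)).isLinear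

/-- A single-valued selection of `signMap`. -/
noncomputable def signMapSelection (x : EuclideanSpace ℝ (Fin n)) : EuclideanSpace ℝ (Fin n) :=
  sgnSelection (inner ℝ C x + D) • (Matrix.toEuclideanLin A x + B)

theorem signMapSelection_mem (x : EuclideanSpace ℝ (Fin n)) :
    signMapSelection A B C D x ∈ signMap A B C D x :=
  ⟨_, sgnSelection_mem _, rfl⟩

theorem norm_signMapSelection_le (x : EuclideanSpace ℝ (Fin n)) :
    ‖signMapSelection A B C D x‖ ≤
      (‖(Matrix.toEuclideanLin A).toContinuousLinearMap‖ + ‖B‖) * (1 + ‖x‖) := by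
  have h1 : |sgnSelection (inner ℝ C x + D)| ≤ 1 :=
    abs_le.2 (sgnSet_subset _ (sgnSelection_mem _))
  have h2 := (Matrix.toEuclideanLin A).toContinuousLinearMap.le_opNorm x
  rw [LinearMap.coe_toContinuousLinearMap'] at h2
  rw [signMapSelection, norm_smul, Real.norm_eq_abs]
  refine (mul_le_of_le_one_left (norm_nonneg _) h1).trans ((norm_add_le _ _).trans ?_)
  nlinarith [norm_nonneg x, norm_nonneg B,
    norm_nonneg (Matrix.toEuclideanLin A).toContinuousLinearMap,
    mul_nonneg (norm_nonneg x) (norm_nonneg B)]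

/-- Upper semicontinuity: the sign chosen at a nearby `y` is also admissible at `x`, so the distance
is at most that between `A y` and `A x`. -/
theorem eventually_exists_mem_signMap_norm_sub_lt (x : EuclideanSpace ℝ (Fin n)) {ε : ℝ}
    (hε : 0 < ε) :
    ∀ᶠ y in 𝓝 x, ∃ w ∈ signMap A B C D x, ‖signMapSelection A B C D y - w‖ < ε := by
  have hc : Continuous fun y : EuclideanSpace ℝ (Fin n) => inner ℝ C y + D := by fun_prop
  have hA : Continuous (Matrix.toEuclideanLin A) := LinearMap.continuous_of_finiteDimensional _
  have hlim : Tendsto (fun y => ‖Matrix.toEuclideanLin A y - Matrix.toEuclideanLin A x‖) (𝓝 x)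
      (𝓝 0) := by
    have : Continuous fun y => ‖Matrix.toEuclideanLin A y - Matrix.toEuclideanLin A x‖ := by
      fun_prop
    simpa using this.tendsto x
  filter_upwards [(hc.tendsto x).eventually (eventually_sgnSelection_mem _),
    hlim.eventually_lt_const hε] with y hy hyε
  refine ⟨_, ⟨_, hy, rfl⟩, ?_⟩
  have h1 : |sgnSelection (inner ℝ C y + D)| ≤ 1 :=
    abs_le.2 (sgnSet_subset _ (sgnSelection_mem _))
  rw [signMapSelection, ← smul_sub, add_sub_add_right_eq_sub, norm_smul, Real.norm_eq_abs]
  exact (mul_le_of_le_one_left (norm_nonneg _) h1).trans_lt hyε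

end SignMap

/-! ### One-sided estimates, uniqueness and the main theorem -/

theorem IsHypomonotone.exists_inner_ge {n : ℕ}
    {F : EuclideanSpace ℝ (Fin n) → Set (EuclideanSpace ℝ (Fin n))} (hF : IsHypomonotone F) :
    ∃ k : ℝ, 0 ≤ k ∧ ∀ x y, ∀ w ∈ F x, ∀ w' ∈ F y,
      -(k * ‖x - y‖ ^ 2) ≤ inner ℝ (x - y) (w - w') := by
  obtain ⟨k, hk, h⟩ := hF
  refine ⟨k, hk, fun x y w hw w' hw' => ?_⟩
  have h1 := h x y _ ⟨w, hw, rfl⟩ _ ⟨w', hw', rfl⟩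
  have h2 : (w + k • x) - (w' + k • y) = (w - w') + k • (x - y) := by rw [smul_sub]; abel
  rw [h2, inner_add_left, real_inner_smul_left, real_inner_self_eq_norm_sq,
    real_inner_comm] at h1
  linarith

/-- The negated sum of hypomonotone maps is one-sided Lipschitz. -/
theorem exists_inner_neg_sum_le {n m : ℕ}
    {F : Fin m → EuclideanSpace ℝ (Fin n) → Set (EuclideanSpace ℝ (Fin n))}
    (hF : ∀ i, IsHypomonotone (F i)) :
    ∃ κ : ℝ, 0 ≤ κ ∧ ∀ x y, ∀ w w' : Fin m → EuclideanSpace ℝ (Fin n), (∀ i, w i ∈ F i x) →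
      (∀ i, w' i ∈ F i y) →
        inner ℝ (x - y) (-(∑ i, w i) - -(∑ i, w' i)) ≤ κ * ‖x - y‖ ^ 2 := by
  choose k hk h using fun i => (hF i).exists_inner_ge
  refine ⟨∑ i, k i, Finset.sum_nonneg fun i _ => hk i, fun x y w w' hw hw' => ?_⟩
  have h1 : -(∑ i, w i) - -(∑ i, w' i) = -∑ i, (w i - w' i) := by
    rw [Finset.sum_sub_distrib]; abel
  rw [h1, inner_neg_right, inner_sum, Finset.sum_mul, ← Finset.sum_neg_distrib]
  exact Finset.sum_le_sum fun i _ => by linarith [h i x y _ (hw i) _ (hw' i)]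

/-- Constant functions are in `L²` of a bounded interval, so `∂f/∂t(·, x)` is in `L²`, hence
integrable. -/
theorem TimeDerivBounded.exists_ae_norm_le {n : ℕ} {T : ℝ}
    {f : ℝ → EuclideanSpace ℝ (Fin n) → EuclideanSpace ℝ (Fin n)} (hf : TimeDerivBounded T f) :
    (∀ x, AEStronglyMeasurable (fun t => f t x) (volume.restrict (Ioo 0 T))) ∧
      ∀ x, ∃ b, 0 ≤ b ∧ ∀ᵐ t ∂(volume.restrict (Ioo 0 T)), ‖f t x‖ ≤ b := by
  obtain ⟨ft, hft, hmeas, Φ, hΦ⟩ := hf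
  refine ⟨fun x => (hft x).1.aestronglyMeasurable, fun x => (hft x).exists_ae_norm_le ?_⟩
  have hx : MemLp (fun _ : ℝ => x) 2 (volume.restrict (Ioo 0 T)) := memLp_const x
  have hle : eLpNorm (fun t => ft t x) 2 (volume.restrict (Ioo 0 T)) ≤
      Φ (eLpNorm (fun _ : ℝ => x) 2 (volume.restrict (Ioo 0 T))).toNNReal := by
    rw [hΦ]
    exact le_sSup ⟨fun _ => x, hx, (ENNReal.coe_toNNReal hx.2.ne).ge, rfl⟩
  exact MemLp.integrable (q := 2) (by norm_num) ⟨hmeas _ hx, hle.trans_lt ENNReal.coe_lt_top⟩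

/-- Two solutions of a one-sided Lipschitz inclusion with the same initial value coincide. -/
theorem IsSolution.eqOn {n m : ℕ} {T : ℝ}
    {f : ℝ → EuclideanSpace ℝ (Fin n) → EuclideanSpace ℝ (Fin n)} (hLip : UniformlyLipschitz T f)
    {F : Fin m → EuclideanSpace ℝ (Fin n) → Set (EuclideanSpace ℝ (Fin n))}
    (hF : ∀ i, IsHypomonotone (F i)) {x₀ : EuclideanSpace ℝ (Fin n)}
    {x y : ℝ → EuclideanSpace ℝ (Fin n)} (hx : IsSolution T f F x₀ x)
    (hy : IsSolution T f F x₀ y) : EqOn x y (Icc 0 T) := by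
  obtain ⟨L, hL, hfL⟩ := hLip
  obtain ⟨κ, hκ, hosl⟩ := exists_inner_neg_sum_le hF
  intro t ht
  have h := AbsolutelyContinuousOnInterval.norm_sq_le_of_inner_le (z := x - y) (K := L + κ)
    (δ := 0) (by positivity) le_rfl (hx.1.sub hy.1) (by simp [hx.2.1, hy.2.1]) (by
      filter_upwards [hx.2.2, hy.2.2, ae_restrict_mem measurableSet_Ioo]
        with s ⟨w, hw, hws⟩ ⟨w', hw', hws'⟩ hs
      refine ⟨_, hws.sub hws', ?_⟩
      have h1 : (f s (x s) - ∑ i, w i) - (f s (y s) - ∑ i, w' i) =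
          (f s (x s) - f s (y s)) + (-(∑ i, w i) - -(∑ i, w' i)) := by abel
      have h2 := hosl _ _ w w' hw hw'
      have h3 := (real_inner_le_norm (x s - y s) (f s (x s) - f s (y s))).trans
        (mul_le_mul_of_nonneg_left (hfL s (Ioo_subset_Icc_self hs) (x s) (y s)) (norm_nonneg _))
      rw [h1, Pi.sub_apply, inner_add_right]
      linarith) ht
  simp only [mul_zero, zero_mul, Pi.sub_apply] at h
  exact sub_eq_zero.1 (norm_eq_zero.1 (pow_eq_zero_iff two_ne_zero |>.1 (h.antisymm (sq_nonneg _))))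

theorem mainTheorem7 {n m : ℕ} (T : ℝ) (hT : 0 < T)
    (f : ℝ → EuclideanSpace ℝ (Fin n) → EuclideanSpace ℝ (Fin n))
    (hLip : UniformlyLipschitz T f) (hTime : TimeDerivBounded T f)
    (A : Fin m → Matrix (Fin n) (Fin n) ℝ) (B C : Fin m → EuclideanSpace ℝ (Fin n))
    (D : Fin m → ℝ)
    (hypo : ∀ i, IsHypomonotone (signMap (A i) (B i) (C i) (D i)))
    (x₀ : EuclideanSpace ℝ (Fin n)) :
    ∃ x : ℝ → EuclideanSpace ℝ (Fin n),
      IsSolution T f (fun i => signMap (A i) (B i) (C i) (D i)) x₀ x ∧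
      (∃ K : ℝ≥0, LipschitzOnWith K x (Icc 0 T)) ∧
      ∀ y : ℝ → EuclideanSpace ℝ (Fin n),
        IsSolution T f (fun i => signMap (A i) (B i) (C i) (D i)) x₀ y →
          EqOn y x (Icc 0 T) := by
  suffices h : ∃ x : ℝ → EuclideanSpace ℝ (Fin n),
      IsSolution T f (fun i => signMap (A i) (B i) (C i) (D i)) x₀ x ∧
      ∃ K : ℝ≥0, LipschitzOnWith K x (Icc 0 T) by
    obtain ⟨x, hx, hK⟩ := h
    exact ⟨x, hx, hK, fun y hy => hy.eqOn hLip hypo hx⟩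
  obtain ⟨κ, hκ, hosl⟩ := exists_inner_neg_sum_le hypo
  obtain ⟨hfm, hfb⟩ := hTime.exists_ae_norm_le
  obtain ⟨L, hL, hfL⟩ := hLip
  obtain ⟨b, hb, hfb⟩ := hfb 0
  classical
  -- discard the times at which `f · 0` exceeds its essential bound
  set g : ℝ → EuclideanSpace ℝ (Fin n) → EuclideanSpace ℝ (Fin n) :=
    fun s x => if s ∈ Ioo 0 T ∧ ‖f s 0‖ ≤ b then f s x else 0 with hg
  have hgm : ∀ x, AEStronglyMeasurable (fun s => g s x) := by
    intro x
    refine ((aestronglyMeasurable_indicator_iff measurableSet_Ioo).2 (hfm x)).congr ?_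
    filter_upwards [(ae_restrict_iff' measurableSet_Ioo).1 hfb] with s hs
    by_cases hsT : s ∈ Ioo 0 T
    · rw [indicator_of_mem hsT, hg]; exact (if_pos ⟨hsT, hs hsT⟩).symm
    · rw [indicator_of_notMem hsT, hg]; exact (if_neg fun h => hsT h.1).symm
  have hgL : ∀ s x y, ‖g s x - g s y‖ ≤ L * ‖x - y‖ := by
    intro s x y
    simp only [hg]
    split_ifs with h
    · exact hfL s (Ioo_subset_Icc_self h.1) x y
    · simp only [sub_self, norm_zero]; positivity
  have hg0 : ∀ s, ‖g s 0‖ ≤ b := by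
    intro s
    simp only [hg]
    split_ifs with h
    exacts [h.2, by simpa using hb]
  set F := fun i => signMap (A i) (B i) (C i) (D i) with hF
  set V : EuclideanSpace ℝ (Fin n) → EuclideanSpace ℝ (Fin n) :=
    fun x => -∑ i, signMapSelection (A i) (B i) (C i) (D i) x with hV
  -- As the linear image of a product of compact convex sets, each value is compact and convex.
  set S : EuclideanSpace ℝ (Fin n) → Set (EuclideanSpace ℝ (Fin n)) :=
    fun x => (fun w : Fin m → EuclideanSpace ℝ (Fin n) => -∑ i, w i) ''
      (Set.univ.pi fun i => F i x) with hS
  obtain ⟨K, x, hx0, hxL, hx⟩ := exists_lipschitz_solution (g := g) (V := V) (S := S) x₀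
    (κ := κ) (c := ∑ i, (‖(Matrix.toEuclideanLin (A i)).toContinuousLinearMap‖ + ‖B i‖))
    hT.le hκ hL (by positivity) hb hgm hgL hg0
    (fun x => by
      rw [hV, norm_neg, Finset.sum_mul]
      exact norm_sum_le_of_le _ fun i _ => norm_signMapSelection_le _ _ _ _ x)
    (fun x y => hosl x y _ _ (fun i => signMapSelection_mem _ _ _ _ x)
      fun i => signMapSelection_mem _ _ _ _ y)
    (fun x => (convex_pi fun i _ => convex_signMap _ _ _ _ x).is_linear_image
      ⟨fun w w' => by simp [Finset.sum_add_distrib, add_comm], fun c w => by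
        simp [Finset.smul_sum]⟩)
    (fun x => ((isCompact_univ_pi fun i => isCompact_signMap _ _ _ _ x).image
      (by fun_prop)).isClosed)
    (fun x η hη => by
      -- Each of the `m` terms contributes at most this much; `m + 1` covers the case `m = 0`.
      have hε : 0 < η / (m + 1) := by positivity
      filter_upwards [eventually_all.2 fun i =>
        eventually_exists_mem_signMap_norm_sub_lt (A i) (B i) (C i) (D i) x hε] with y hy
      choose w hw hwy using hy
      refine Metric.mem_cthickening_of_dist_le _ _ _ _ ⟨w, fun i _ => hw i, rfl⟩ ?_
      rw [dist_neg_neg, dist_eq_norm, ← Finset.sum_sub_distrib]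
      refine (norm_sum_le_of_le _ fun i _ => (hwy i).le).trans ?_
      rw [Finset.sum_const, Finset.card_univ, Fintype.card_fin, nsmul_eq_mul, mul_div_assoc',
        div_le_iff₀ (by positivity)]
      nlinarith)
  refine ⟨x, ⟨?_, hx0, ?_⟩, K, hxL⟩
  · exact LipschitzOnWith.absolutelyContinuousOnInterval (by rwa [uIcc_of_le hT.le])
  · filter_upwards [hx, hfb, ae_restrict_mem measurableSet_Ioo] with t ⟨v, ⟨w, hw, hwv⟩, hv⟩ htb ht
    refine ⟨w, fun i => hw i (mem_univ i), ?_⟩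
    have h1 : g t (x t) = f t (x t) := if_pos ⟨ht, htb⟩
    rw [h1, ← hwv, ← sub_eq_add_neg] at hv
    exact hv
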